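/- **Theorem 3 (Weak converse for Gaussian models).** Let $\alpha<1$ be a constant, and for each $p\in\mathbb N$ let $c=c_p$ be a real number; assume that $c_p$ is bounded below by a positive constant for all large $p$ and that $c_p=O((\log p)^k)$ for some $k\in\mathbb N$ (for instance, $c$ is a positive constant). Let $G$ be an Erdős–Rényi random graph $\mathcal G_{\mathrm{ER}}(p,c/p)$ on $\{1,\dots,p\}$: each pair of nodes is an edge with probability $c/p$, independently. To every graph $g$ on $\{1,\dots,p\}$ let there be assigned a symmetric positive definite precision matrix $\mathbf J_g$ with unit diagonal and, for $i\ne j$, $J_g(i,j)=0$ if and only if $(i,j)\notin g$. Put $R_g(i,i)=0$ and $R_g(i,j)=-J_g(i,j)/\sqrt{J_g(i,i)J_g(j,j)}$ for $i\ne j$, so that $\mathbf J_g=\mathbf I-\mathbf R_g$, and assume that the model is $\alpha$-walk-summable for almost every graph: with $\overline{\mathbf R}_g=[|R_g(i,j)|]$ and $\|\cdot\|$ the spectral norm, $P(\|\overline{\mathbf R}_G\|\le\alpha)\to1$ as $p\to\infty$. Given $G$, let $\mathbf X^n=(\mathbf X_1,\dots,\mathbf X_n)$ be $n=n_p$ i.i.d.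 samples in $\mathbb R^p$ from the zero-mean Gaussian density proportional to $\exp(-\tfrac12\mathbf x^T\mathbf J_G\mathbf x)$, and let $\widehat G=\widehat G(\mathbf X^n)$ be any (measurable) estimator of $G$. If the error probability $P(\widehat G\ne G)$, taken over both $G$ and $\mathbf X^n$, tends to $0$ as $p\to\infty$, then $$n\ \ge\ \frac{2}{p\,\log_2\!\left[2\pi e\left(\frac1{1-\alpha}+1\right)\right]}\binom p2\,H_b\!\left(\frac cp\right)\qquad\text{for all sufficiently large }p,$$ where $H_b(q)=-q\log_2 q-(1-q)\log_2(1-q)$ is the binary entropy in bits, and also $$n\ \ge\ \frac{c\,\log_2 p}{\log_2\!\left[2\pi e\left(\frac1{1-\alpha}+1\right)\right]}\qquad\text{for all sufficiently large }p.$$ -/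

import Mathlib

open MeasureTheory Filter Topology Asymptotics

noncomputable section

namespace GaussianGraphical

/-- The zero-mean Gaussian distribution on `ℝ^p` in information form: the measure with density
`sqrt (det J / (2π)^p) * exp (-(1/2) xᵀ J x)` for a (positive definite) precision matrix `J`. -/
def gaussianLaw {p : ℕ} (J : Matrix (Fin p) (Fin p) ℝ) : Measure (Fin p → ℝ) :=
  volume.withDensity fun x =>
    ENNReal.ofReal (Real.sqrt (J.det / (2 * Real.pi) ^ p) * Real.exp (-(1 / 2) * (x ⬝ᵥ J.mulVec x)))

/-- `J` is the precision (information) matrix of a Gaussian graphical model Markov on `G`: it is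
symmetric positive definite, and its off-diagonal sparsity pattern is exactly that of `G`. -/
structure IsPrecisionOn {p : ℕ} (G : SimpleGraph (Fin p)) (J : Matrix (Fin p) (Fin p) ℝ) :
    Prop where
  posDef : J.PosDef
  sparsity : ∀ i j, i ≠ j → (J i j = 0 ↔ ¬ G.Adj i j)

/-- The partial correlation matrix: `R i i = 0` and `R i j = - J i j / sqrt (J i i * J j j)`. -/
def partialCorr {p : ℕ} (J : Matrix (Fin p) (Fin p) ℝ) : Matrix (Fin p) (Fin p) ℝ :=
  Matrix.of fun i j => if i = j then 0 else -J i j / Real.sqrt (J i i * J j j)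

/-- `α`-walk-summability: the entrywise absolute value of the partial correlation matrix has
spectral norm (operator norm on Euclidean space) at most `α`, and `α < 1`. -/
def WalkSummable {p : ℕ} (α : ℝ) (J : Matrix (Fin p) (Fin p) ℝ) : Prop :=
  ‖Matrix.toEuclideanCLM (𝕜 := ℝ) ((partialCorr J).map fun r => |r|)‖ ≤ α ∧ α < 1

/-- The Erdős–Rényi law on graphs with vertex set `Fin p`, with edge probability `c / p`
(truncated to `[0, 1]`, which matters only when `c / p` is not a probability). -/
def erdosRenyi (p : ℕ) (c : ℝ) : Measure (SimpleGraph (Fin p)) :=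
  SimpleGraph.binomialRandom (Fin p) (Set.projIcc (0 : ℝ) 1 zero_le_one (c / p))

/-- The joint law of the random graph `G` and of `n` samples which, conditionally on `G`, are
i.i.d. with the zero-mean Gaussian law of precision matrix `J G`. -/
def jointLaw {p : ℕ} (μ : Measure (SimpleGraph (Fin p)))
    (J : SimpleGraph (Fin p) → Matrix (Fin p) (Fin p) ℝ) (n : ℕ) :
    Measure (SimpleGraph (Fin p) × (Fin n → Fin p → ℝ)) :=
  Measure.sum fun G : SimpleGraph (Fin p) =>
    μ {G} • (Measure.pi fun _ : Fin n => gaussianLaw (J G)).map (Prod.mk G)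

/-- The probability, over both the graph and the samples, that the estimate of the graph computed
from the samples differs from the graph. -/
def errorProb {p : ℕ} (μ : Measure (SimpleGraph (Fin p)))
    (J : SimpleGraph (Fin p) → Matrix (Fin p) (Fin p) ℝ) (n : ℕ)
    (est : (Fin n → Fin p → ℝ) → SimpleGraph (Fin p)) : ENNReal :=
  jointLaw μ J n {z | est z.2 ≠ z.1}

/-- The binary entropy function in bits, `-q log₂ q - (1 - q) log₂ (1 - q)`. -/
def binEntropyBits (q : ℝ) : ℝ := -q * Real.logb 2 q - (1 - q) * Real.logb 2 (1 - q)

end GaussianGraphical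

end

/-! The proof is a change of measure rather than Fano's inequality. Unit diagonal gives `det J ≤ 1`
and walk-summability gives `J ≥ (1 - α) I`, so each good Gaussian law is at most `(1 - α)^(-p/2)`
times one fixed isotropic law (`gaussianLaw_le_smul`). The decision regions of an estimator are
disjoint, so under the product of that isotropic law their masses sum to at most one. Hence success
has probability at most `δ (1 - α)^(-np/2)`, up to exceptional graphs, where `δ` bounds the prior
mass of a typical graph (`one_le_errorProb_add`).

With `N = p.choose 2` and `H` the entropy of one edge in nats, a Chernoff bound makes all but
negligible mass sit on graphs of mass at most `exp (-(1 - ε) N H)`. Vanishing error then forces `n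
(p/2) log (1/(1 - α))` to be nearly `N H`. The stated bound has the strictly larger `log (2πe (1/(1
- α) + 1))`; this gap absorbs `ε` and leaves a spare factor `δ > 1`, which also pays for replacing
`(p - 1) H` by `c log p`. -/

noncomputable section

namespace GaussianGraphical

open Matrix

/-! ### Domination of the Gaussian laws by isotropic noise -/

/-- A positive definite matrix with unit diagonal has determinant at most one. -/
lemma det_le_one_of_diag_eq_one {ι : Type*} [Fintype ι] [DecidableEq ι] {J : Matrix ι ι ℝ}
    (hJ : J.PosDef) (hd : ∀ i, J i i = 1) : J.det ≤ 1 := by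
  have htr : ∑ i, hJ.1.eigenvalues i = Fintype.card ι := by
    have h := hJ.1.trace_eq_sum_eigenvalues
    simp only [Matrix.trace, Matrix.diag_apply, hd] at h
    simpa using h.symm
  have hdet : J.det = ∏ i, hJ.1.eigenvalues i := by
    simpa using hJ.1.det_eq_prod_eigenvalues
  rw [hdet]
  -- `t ≤ exp (t - 1)` for each eigenvalue; the trace condition makes the exponents sum to zero.
  calc ∏ i, hJ.1.eigenvalues i ≤ ∏ i, Real.exp (hJ.1.eigenvalues i - 1) :=
        Finset.prod_le_prod (fun i _ => (hJ.eigenvalues_pos i).le)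
          fun i _ => by linarith [Real.add_one_le_exp (hJ.1.eigenvalues i - 1)]
    _ = 1 := by
        rw [← Real.exp_sum, Finset.sum_sub_distrib, htr]
        simp

/-- The quadratic form of a matrix is at most the spectral norm of its entrywise absolute value
times the squared length. -/
lemma dotProduct_mulVec_le_opNorm_abs {ι : Type*} [Fintype ι] [DecidableEq ι]
    (R : Matrix ι ι ℝ) (x : ι → ℝ) :
    x ⬝ᵥ R *ᵥ x ≤ ‖Matrix.toEuclideanCLM (𝕜 := ℝ) (R.map fun r => |r|)‖ * (x ⬝ᵥ x) := by
  set T := Matrix.toEuclideanCLM (𝕜 := ℝ) (R.map fun r => |r|) with hT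
  set y : EuclideanSpace ℝ ι := WithLp.toLp 2 fun i => |x i| with hy
  have hyy : ‖y‖ * ‖y‖ = x ⬝ᵥ x := by
    rw [← real_inner_self_eq_norm_mul_norm]
    simp only [hy, PiLp.inner_apply, dotProduct]
    exact Finset.sum_congr rfl fun i _ => by simp [← sq]
  calc x ⬝ᵥ R *ᵥ x ≤ (fun i => |x i|) ⬝ᵥ (R.map fun r => |r|) *ᵥ (fun i => |x i|) := by
        simp only [dotProduct, mulVec, Finset.mul_sum, Matrix.map_apply]
        refine Finset.sum_le_sum fun i _ => Finset.sum_le_sum fun j _ => ?_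
        rw [← abs_mul, ← abs_mul]
        exact le_abs_self _
    _ = inner ℝ y (T y) := (inner_toEuclideanCLM _ y y).symm
    _ ≤ ‖y‖ * ‖T y‖ := real_inner_le_norm _ _
    _ ≤ ‖y‖ * (‖T‖ * ‖y‖) := by gcongr; exact T.le_opNorm y
    _ = ‖T‖ * (x ⬝ᵥ x) := by rw [← hyy]; ring

/-- Walk-summability bounds the precision matrix below by `(1 - α) I`. -/
lemma WalkSummable.le_dotProduct_mulVec {p : ℕ} {α : ℝ} {J : Matrix (Fin p) (Fin p) ℝ}
    (h : WalkSummable α J) (hd : ∀ i, J i i = 1) (x : Fin p → ℝ) :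
    (1 - α) * (x ⬝ᵥ x) ≤ x ⬝ᵥ J *ᵥ x := by
  have hJ : J = 1 - partialCorr J := by
    ext i j
    by_cases hij : i = j
    · subst hij; simp [partialCorr, hd]
    · simp [partialCorr, hd, hij]
  have hx : 0 ≤ x ⬝ᵥ x := Finset.sum_nonneg fun i _ => mul_self_nonneg (x i)
  have h1 := dotProduct_mulVec_le_opNorm_abs (partialCorr J) x
  have h2 := mul_le_mul_of_nonneg_right h.1 hx
  have h3 : x ⬝ᵥ J *ᵥ x = x ⬝ᵥ x - x ⬝ᵥ partialCorr J *ᵥ x := by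
    conv_lhs => rw [hJ]
    rw [sub_mulVec, one_mulVec, dotProduct_sub]
  linarith

lemma WalkSummable.nonneg {p : ℕ} {α : ℝ} {J : Matrix (Fin p) (Fin p) ℝ}
    (h : WalkSummable α J) : 0 ≤ α :=
  (norm_nonneg _).trans h.1

lemma lintegral_exp_neg_half_dotProduct_self (ι : Type*) [Fintype ι] :
    ∫⁻ x : ι → ℝ, ENNReal.ofReal (Real.exp (-(1 / 2) * (x ⬝ᵥ x))) =
      ENNReal.ofReal (Real.sqrt ((2 * Real.pi) ^ Fintype.card ι)) := by
  have hprod : ∀ x : ι → ℝ,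
      Real.exp (-(1 / 2) * (x ⬝ᵥ x)) = ∏ i, Real.exp (-(1 / 2) * x i ^ 2) := by
    intro x
    rw [← Real.exp_sum, dotProduct, Finset.mul_sum]
    simp only [sq]
  have hint : Integrable fun x : ι → ℝ => ∏ i, Real.exp (-(1 / 2) * x i ^ 2) :=
    Integrable.fintype_prod fun _ => integrable_exp_neg_mul_sq (by norm_num)
  simp only [hprod]
  rw [← ofReal_integral_eq_lintegral_ofReal hint
    (ae_of_all _ fun x => Finset.prod_nonneg fun i _ => (Real.exp_pos _).le),
    integral_fintype_prod_volume_eq_pow (fun t : ℝ => Real.exp (-(1 / 2) * t ^ 2)),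
    integral_gaussian]
  congr 1
  rw [eq_comm, Real.sqrt_eq_iff_mul_self_eq (by positivity) (by positivity), ← mul_pow,
    Real.mul_self_sqrt (by positivity)]
  congr 1
  ring

/-- The zero-mean Gaussian density of a positive definite precision matrix is normalized. -/
lemma isProbabilityMeasure_gaussianLaw {p : ℕ} {J : Matrix (Fin p) (Fin p) ℝ} (hJ : J.PosDef) :
    IsProbabilityMeasure (gaussianLaw J) := by
  -- The linear change of variables `x ↦ B x` reduces the integral to the standard Gaussian.
  obtain ⟨B, hB⟩ : ∃ B : Matrix (Fin p) (Fin p) ℝ, J = Bᵀ * B := by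
    open scoped MatrixOrder in
    obtain ⟨B, hB⟩ := CStarAlgebra.nonneg_iff_eq_star_mul_self.mp hJ.posSemidef.nonneg
    exact ⟨B, by simpa [star_eq_conjTranspose] using hB⟩
  have hdet : J.det = B.det ^ 2 := by rw [hB, det_mul, det_transpose, sq]
  have hB0 : B.det ≠ 0 := by
    intro h
    have := hJ.det_pos
    simp [hdet, h] at this
  have hquad : ∀ x, x ⬝ᵥ J *ᵥ x = (toLin' B x) ⬝ᵥ (toLin' B x) := by
    intro x
    rw [hB, toLin'_apply, ← mulVec_mulVec, dotProduct_mulVec, vecMul_transpose]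
  have hmeas : Measurable fun x : Fin p → ℝ =>
      ENNReal.ofReal (Real.exp (-(1 / 2) * (x ⬝ᵥ x))) := by
    unfold dotProduct; fun_prop
  have hint : ∫⁻ x : Fin p → ℝ, ENNReal.ofReal (Real.exp (-(1 / 2) * (x ⬝ᵥ J *ᵥ x))) =
      ENNReal.ofReal |B.det⁻¹| * ENNReal.ofReal (Real.sqrt ((2 * Real.pi) ^ p)) := by
    simp only [hquad]
    rw [← lintegral_map (f := fun x : Fin p → ℝ =>
        ENNReal.ofReal (Real.exp (-(1 / 2) * (x ⬝ᵥ x)))) hmeas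
        (toLin' B).continuous_of_finiteDimensional.measurable,
      Real.map_matrix_volume_pi_eq_smul_volume_pi hB0, lintegral_smul_measure,
      lintegral_exp_neg_half_dotProduct_self, Fintype.card_fin, smul_eq_mul]
  constructor
  rw [gaussianLaw, withDensity_apply _ MeasurableSet.univ, Measure.restrict_univ]
  simp only [ENNReal.ofReal_mul (Real.sqrt_nonneg _)]
  rw [lintegral_const_mul' _ _ ENNReal.ofReal_ne_top, hint, ← ENNReal.ofReal_mul (abs_nonneg _),
    ← ENNReal.ofReal_mul (Real.sqrt_nonneg _), hdet, Real.sqrt_div (sq_nonneg _),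
    Real.sqrt_sq_eq_abs, abs_inv]
  have h1 : |B.det| ≠ 0 := abs_ne_zero.mpr hB0
  have h2 : Real.sqrt ((2 * Real.pi) ^ p) ≠ 0 := by positivity
  rw [← ENNReal.ofReal_one]
  congr 1
  field_simp

/-- A Gaussian law with precision `J ≥ s I` and `det J ≤ 1` is dominated by a multiple of the
isotropic Gaussian law of precision `s I`. -/
lemma gaussianLaw_le_smul {p : ℕ} {J : Matrix (Fin p) (Fin p) ℝ} {s : ℝ} (hs : 0 < s)
    (hdet : J.det ≤ 1) (hJ : ∀ x : Fin p → ℝ, s * (x ⬝ᵥ x) ≤ x ⬝ᵥ J *ᵥ x) :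
    gaussianLaw J ≤ ENNReal.ofReal (Real.sqrt (s⁻¹ ^ p)) •
      gaussianLaw (s • (1 : Matrix (Fin p) (Fin p) ℝ)) := by
  unfold gaussianLaw
  rw [← withDensity_smul' _ _ ENNReal.ofReal_ne_top]
  refine withDensity_mono (ae_of_all _ fun x => ?_)
  simp only [Pi.smul_apply, smul_eq_mul]
  rw [← ENNReal.ofReal_mul (Real.sqrt_nonneg _)]
  refine ENNReal.ofReal_le_ofReal ?_
  rw [← mul_assoc, ← Real.sqrt_mul (by positivity)]
  have hx := hJ x
  refine mul_le_mul ?_ ?_ (Real.exp_pos _).le (Real.sqrt_nonneg _)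
  · refine Real.sqrt_le_sqrt ?_
    rw [det_smul, det_one, Fintype.card_fin, mul_one, ← mul_div_assoc, ← mul_pow,
      inv_mul_cancel₀ hs.ne', one_pow]
    gcongr
  · refine Real.exp_le_exp.mpr ?_
    rw [smul_mulVec, one_mulVec, dotProduct_smul, smul_eq_mul]
    linarith

/-- Domination on boxes extends to all measurable sets because `OuterMeasure.pi` is the largest
outer measure bounded by the product on boxes. -/
lemma pi_const_le_smul {Ω : Type*} [MeasurableSpace Ω] {μ ν : Measure Ω} [SigmaFinite μ]
    [IsFiniteMeasure ν] {b : ENNReal} (hb : b ≠ ⊤) (h : μ ≤ b • ν) (n : ℕ) :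
    Measure.pi (fun _ : Fin n => μ) ≤ b ^ n • Measure.pi fun _ : Fin n => ν := by
  have : IsFiniteMeasure (b • ν) := Measure.smul_finite ν hb
  have hpi : Measure.pi (fun _ : Fin n => b • ν) = b ^ n • Measure.pi fun _ : Fin n => ν :=
    Measure.pi_eq fun s _ => by simp [Finset.prod_mul_distrib]
  rw [← hpi, Measure.le_iff]
  intro S hS
  have hle : (Measure.pi fun _ : Fin n => μ).toOuterMeasure ≤
      OuterMeasure.pi fun _ : Fin n => (b • ν).toOuterMeasure := by
    refine OuterMeasure.le_pi.mpr fun s _ => ?_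
    simp only [Measure.coe_toOuterMeasure, Measure.pi_pi]
    exact Finset.prod_le_prod' fun i _ => h (s i)
  conv_rhs => rw [Measure.pi, toMeasure_apply _ _ hS]
  exact hle S

/-! ### Edge counts and point masses of the binomial random graph -/

lemma ncard_edgeSet_le_choose {p : ℕ} (G : SimpleGraph (Fin p)) :
    G.edgeSet.ncard ≤ p.choose 2 := by
  classical
  have h := G.card_edgeFinset_le_card_choose_two
  rwa [Fintype.card_fin, ← Set.ncard_coe_finset, SimpleGraph.coe_edgeFinset] at h

lemma binomialRandom_real_singleton {p : ℕ} (q : unitInterval) (G : SimpleGraph (Fin p)) :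
    (SimpleGraph.binomialRandom (Fin p) q).real {G} =
      (q : ℝ) ^ G.edgeSet.ncard * (1 - q : ℝ) ^ (p.choose 2 - G.edgeSet.ncard) := by
  simp [measureReal_def]

instance {p : ℕ} : MeasurableSingletonClass (SimpleGraph (Fin p)) where
  measurableSet_singleton G := by
    have : {G} = SimpleGraph.edgeSet ⁻¹' {G.edgeSet} := by
      ext H; simp
    rw [this]
    exact SimpleGraph.measurable_edgeSet (measurableSet_singleton _)

lemma real_le_of_forall_singleton_le {Ω : Type*} [Finite Ω] [MeasurableSpace Ω]
    [MeasurableSingletonClass Ω] {μ ν : Measure Ω} [IsFiniteMeasure μ] [IsProbabilityMeasure ν]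
    {S : Set Ω} {K : ℝ} (hK : 0 ≤ K) (h : ∀ ω ∈ S, μ.real {ω} ≤ K * ν.real {ω}) : μ.real S ≤ K := by
  classical
  lift S to Finset Ω using S.toFinite
  rw [← sum_measureReal_singleton]
  calc ∑ ω ∈ S, μ.real {ω} ≤ ∑ ω ∈ S, K * ν.real {ω} := Finset.sum_le_sum h
    _ = K * ν.real S := by rw [← Finset.mul_sum, sum_measureReal_singleton]
    _ ≤ K := mul_le_of_le_one_right hK measureReal_le_one

lemma exp_neg_le_quadratic {x : ℝ} (hx : 0 ≤ x) : Real.exp (-x) ≤ 1 - x + x ^ 2 / 2 := by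
  rw [Real.exp_neg]
  have h := Real.quadratic_le_exp_of_nonneg hx
  have h0 : 0 < 1 + x + x ^ 2 / 2 := by positivity
  refine (inv_anti₀ h0 h).trans ?_
  rw [inv_le_iff_one_le_mul₀ h0]
  -- `(1 + x + x²/2)(1 - x + x²/2) = 1 + x⁴/4`.
  nlinarith [sq_nonneg (x ^ 2)]

/-- Chernoff lower-tail bound for the number of edges of a binomial random graph. -/
lemma binomialRandom_edges_lower_tail {p : ℕ} (q : unitInterval) (hq0 : 0 < (q : ℝ))
    (hq1 : (q : ℝ) < 1) {ε : ℝ} (hε : 0 ≤ ε) :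
    (SimpleGraph.binomialRandom (Fin p) q).real
      {G | (G.edgeSet.ncard : ℝ) ≤ (1 - ε) * (p.choose 2 * q)} ≤
      Real.exp (-(p.choose 2 * q * ε ^ 2 / 2)) := by
  set z := Real.exp (-ε) with hz
  have hz0 : 0 < z := Real.exp_pos _
  set D : ℝ := 1 - q + q * z with hD
  have hD0 : 0 < D := by have := mul_pos hq0 hz0; linarith
  have hDexp : D ≤ Real.exp (-(q * (ε - ε ^ 2 / 2))) := by
    have h1 := exp_neg_le_quadratic hε
    have h2 := Real.add_one_le_exp (-(q * (ε - ε ^ 2 / 2) : ℝ))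
    have h3 := mul_le_mul_of_nonneg_left h1 hq0.le
    linarith
  -- Exponential tilting by `z ^ edges` yields another binomial random graph, with edge probability
  -- `q'`. The likelihood ratio is `D ^ N / z ^ m` for `m` edges among `N` pairs, so Chernoff
  -- becomes a comparison of point masses.
  let q' : unitInterval := ⟨q * z / D, by positivity, by
    rw [div_le_one hD0]; linarith⟩
  have hq' : (q' : ℝ) = q * z / D := rfl
  have hq'1 : 1 - (q' : ℝ) = (1 - q) / D := by rw [hq']; field_simp; linarith
  refine real_le_of_forall_singleton_le (ν := SimpleGraph.binomialRandom (Fin p) q')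
    (Real.exp_pos _).le fun G hG => ?_
  rw [binomialRandom_real_singleton, binomialRandom_real_singleton, hq'1, hq']
  have hm := ncard_edgeSet_le_choose G
  simp only [Set.mem_ofPred_eq] at hG
  generalize G.edgeSet.ncard = m at hm hG ⊢
  obtain ⟨k, hk⟩ := Nat.exists_eq_add_of_le hm
  rw [hk] at hG ⊢
  rw [Nat.add_sub_cancel_left, div_pow, div_pow, mul_pow]
  have key : D ^ (m + k) ≤ Real.exp (-(((m + k : ℕ) : ℝ) * q * ε ^ 2 / 2)) * z ^ m := by
    calc D ^ (m + k) ≤ Real.exp (-(q * (ε - ε ^ 2 / 2))) ^ (m + k) := by gcongr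
      _ = Real.exp (((m + k : ℕ) : ℝ) * -(q * (ε - ε ^ 2 / 2))) := (Real.exp_nat_mul _ _).symm
      _ ≤ Real.exp (-(((m + k : ℕ) : ℝ) * q * ε ^ 2 / 2) + m * -ε) := by
          refine Real.exp_le_exp.mpr ?_
          have := mul_le_mul_of_nonneg_left hG hε
          linarith
      _ = _ := by rw [Real.exp_add, hz, ← Real.exp_nat_mul]
  have hpos : 0 ≤ (q : ℝ) ^ m * (1 - q) ^ k :=
    mul_nonneg (pow_nonneg hq0.le _) (pow_nonneg (by linarith) _)
  calc (q : ℝ) ^ m * (1 - q) ^ k = (q : ℝ) ^ m * (1 - q) ^ k * D ^ (m + k) / D ^ (m + k) := by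
        field_simp
    _ ≤ (q : ℝ) ^ m * (1 - q) ^ k *
        (Real.exp (-(((m + k : ℕ) : ℝ) * q * ε ^ 2 / 2)) * z ^ m) / D ^ (m + k) := by gcongr
    _ = _ := by rw [pow_add]; field_simp

/-- A sparse binomial random graph gives small mass to every graph that does not have too few
edges. -/
lemma binomialRandom_real_singleton_le {p : ℕ} (q : unitInterval) (hq0 : 0 < (q : ℝ))
    (hq1 : (q : ℝ) ≤ 1 / 2) {ε : ℝ} (hε : 0 ≤ ε) {G : SimpleGraph (Fin p)}
    (hG : (1 - ε) * (p.choose 2 * q) ≤ G.edgeSet.ncard) :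
    (SimpleGraph.binomialRandom (Fin p) q).real {G} ≤
      Real.exp (-((1 - ε) * (p.choose 2 * Real.binEntropy q))) := by
  rw [binomialRandom_real_singleton]
  have hm := ncard_edgeSet_le_choose G
  generalize G.edgeSet.ncard = m at hm hG ⊢
  obtain ⟨k, hk⟩ := Nat.exists_eq_add_of_le hm
  rw [hk] at hG ⊢
  have h1q : 0 < 1 - (q : ℝ) := by linarith
  rw [Nat.add_sub_cancel_left]
  nth_rw 1 [← Real.exp_log hq0]
  nth_rw 1 [← Real.exp_log h1q]
  rw [← Real.exp_nat_mul, ← Real.exp_nat_mul, ← Real.exp_add]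
  refine Real.exp_le_exp.mpr ?_
  rw [Real.binEntropy_eq_negMulLog_add_negMulLog_one_sub, Real.negMulLog, Real.negMulLog]
  push_cast at hG ⊢
  -- The log-mass `N log (1 - q) + m (log q - log (1 - q))` is nonincreasing in `m` since `q ≤ 1/2`.
  have hlog : Real.log q ≤ Real.log (1 - q) := Real.log_le_log hq0 (by linarith)
  have hneg : Real.log (1 - q) ≤ 0 := Real.log_nonpos h1q.le (by linarith)
  have h1 := mul_le_mul_of_nonneg_right hG (sub_nonneg.mpr hlog)
  have h2 : 0 ≤ ε * ((m + k : ℝ) * -Real.log (1 - q)) :=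
    mul_nonneg hε (mul_nonneg (by positivity) (by linarith))
  linarith

/-! ### The change-of-measure converse -/

lemma errorProb_eq_sum {p : ℕ} (μ : Measure (SimpleGraph (Fin p)))
    (J : SimpleGraph (Fin p) → Matrix (Fin p) (Fin p) ℝ) (n : ℕ)
    {est : (Fin n → Fin p → ℝ) → SimpleGraph (Fin p)} (hest : Measurable est) :
    errorProb μ J n est =
      ∑ G, μ {G} * Measure.pi (fun _ : Fin n => gaussianLaw (J G)) (est ⁻¹' {G})ᶜ := by
  have hS : MeasurableSet {z : SimpleGraph (Fin p) × (Fin n → Fin p → ℝ) | est z.2 ≠ z.1} :=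
    (measurableSet_eq_fun (hest.comp measurable_snd) measurable_fst).compl
  rw [errorProb, jointLaw, Measure.sum_apply _ hS, tsum_fintype]
  refine Finset.sum_congr rfl fun G _ => ?_
  rw [Measure.smul_apply, smul_eq_mul, Measure.map_apply measurable_prodMk_left hS]
  rfl

/-- A strong converse bound: if all graphs outside `B` have mass at most `δ`, then the error
probability, the mass of `B`, the mass of the graphs that are not walk-summable, and `δ` times the
largest likelihood ratio against isotropic noise add up to at least one. -/
lemma one_le_errorProb_add {p : ℕ} (μ : Measure (SimpleGraph (Fin p))) [IsProbabilityMeasure μ]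
    {J : SimpleGraph (Fin p) → Matrix (Fin p) (Fin p) ℝ} (hJ : ∀ G, (J G).PosDef)
    (hdiag : ∀ G i, J G i i = 1) {α : ℝ} (hα : α < 1) {n : ℕ}
    {est : (Fin n → Fin p → ℝ) → SimpleGraph (Fin p)} (hest : Measurable est)
    {B : Set (SimpleGraph (Fin p))} {δ : ENNReal} (hB : ∀ G ∉ B, μ {G} ≤ δ) :
    1 ≤ errorProb μ J n est + μ {G | WalkSummable α (J G)}ᶜ + μ B +
      δ * ENNReal.ofReal (Real.sqrt ((1 - α)⁻¹ ^ p)) ^ n := by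
  have hs : 0 < 1 - α := by linarith
  set T := {G | WalkSummable α (J G)} with hT
  set b := ENNReal.ofReal (Real.sqrt ((1 - α)⁻¹ ^ p)) with hb
  set P := fun G => Measure.pi fun _ : Fin n => gaussianLaw (J G) with hP
  have hprob : ∀ G, IsProbabilityMeasure (gaussianLaw (J G)) :=
    fun G => isProbabilityMeasure_gaussianLaw (hJ G)
  have hQ1 : IsProbabilityMeasure (gaussianLaw ((1 - α) • (1 : Matrix (Fin p) (Fin p) ℝ))) :=
    isProbabilityMeasure_gaussianLaw (Matrix.PosDef.one.smul hs)
  set Q := Measure.pi fun _ : Fin n =>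
    gaussianLaw ((1 - α) • (1 : Matrix (Fin p) (Fin p) ℝ)) with hQ
  have hpre : ∀ G, MeasurableSet (est ⁻¹' {G}) := fun G => hest (measurableSet_singleton G)
  have hsum : ∀ S : Set (SimpleGraph (Fin p)), ∑ G, S.indicator (fun G => μ {G}) G = μ S := by
    intro S
    rw [← tsum_fintype (L := .unconditional _)]
    exact μ.tsum_indicator_apply_singleton S S.toFinite.measurableSet
  have hterm : ∀ G, μ {G} ≤ μ {G} * P G (est ⁻¹' {G})ᶜ + (Tᶜ.indicator (fun G => μ {G}) G +
      B.indicator (fun G => μ {G}) G + δ * b ^ n * Q (est ⁻¹' {G})) := by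
    intro G
    have hsplit : μ {G} = μ {G} * P G (est ⁻¹' {G})ᶜ + μ {G} * P G (est ⁻¹' {G}) := by
      rw [← mul_add, add_comm, prob_add_prob_compl (hpre G), mul_one]
    nth_rw 1 [hsplit]
    gcongr
    by_cases h1 : G ∈ T
    · by_cases h2 : G ∈ B
      · rw [Set.indicator_of_mem h2]
        refine (mul_le_of_le_one_right' prob_le_one).trans ?_
        exact le_add_right le_add_self
      · refine le_add_left ?_
        rw [mul_assoc]
        refine mul_le_mul' (hB G h2) ?_
        have hle := pi_const_le_smul ENNReal.ofReal_ne_top (gaussianLaw_le_smul hs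
          (det_le_one_of_diag_eq_one (hJ G) (hdiag G)) (h1.le_dotProduct_mulVec (hdiag G))) n
        simpa only [Measure.smul_apply, smul_eq_mul] using hle (est ⁻¹' {G})
    · rw [Set.indicator_of_mem (Set.mem_compl h1)]
      refine (mul_le_of_le_one_right' prob_le_one).trans ?_
      exact le_add_right (le_add_right le_rfl)
  calc (1 : ENNReal) = ∑ G, μ {G} := by
        rw [← measure_univ (μ := μ), ← hsum Set.univ]; simp
    _ ≤ ∑ G, (μ {G} * P G (est ⁻¹' {G})ᶜ + (Tᶜ.indicator (fun G => μ {G}) G +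
          B.indicator (fun G => μ {G}) G + δ * b ^ n * Q (est ⁻¹' {G}))) :=
        Finset.sum_le_sum fun G _ => hterm G
    _ = errorProb μ J n est + (μ Tᶜ + μ B + δ * b ^ n * ∑ G, Q (est ⁻¹' {G})) := by
        rw [Finset.sum_add_distrib, Finset.sum_add_distrib, Finset.sum_add_distrib, hsum, hsum,
          errorProb_eq_sum μ J n hest, Finset.mul_sum]
    _ ≤ errorProb μ J n est + (μ Tᶜ + μ B + δ * b ^ n * 1) := by
        gcongr
        -- The decision regions partition the sample space, and `Q` does not depend on `G`.
        rw [sum_measure_preimage_singleton _ fun G _ => hpre G]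
        exact prob_le_one
    _ = _ := by rw [mul_one]; ring

/-! ### Asymptotics of the entropy and constants -/

/-- A polylogarithmic sequence is eventually below every positive power. -/
lemma eventually_log_le_mul_log {c : ℕ → ℝ} {c₀ : ℝ} (hc₀ : 0 < c₀)
    (hc : ∀ᶠ p in atTop, c₀ ≤ c p) {k : ℕ} (hk : c =O[atTop] fun p : ℕ => Real.log p ^ k)
    {η : ℝ} (hη : 0 < η) : ∀ᶠ p : ℕ in atTop, Real.log (c p) ≤ η * Real.log p := by
  have h1 : (fun x : ℝ => Real.log x ^ k) =o[atTop] fun x => x ^ η := by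
    simpa using isLittleO_log_rpow_rpow_atTop (s := η) (k : ℝ) hη
  have h2 := (hk.trans_isLittleO (h1.comp_tendsto tendsto_natCast_atTop_atTop)).bound one_pos
  filter_upwards [h2, hc, eventually_gt_atTop 0] with p hp hcp hp0
  have hp0' : (0 : ℝ) < p := by exact_mod_cast hp0
  have hcp0 : 0 < c p := hc₀.trans_le hcp
  rw [← Real.log_rpow hp0']
  refine Real.log_le_log hcp0 ?_
  have h3 : |c p| ≤ |(p : ℝ) ^ η| := by simpa using hp
  rwa [abs_of_pos hcp0, abs_of_pos (Real.rpow_pos_of_pos hp0' η)] at h3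

lemma tendsto_log_natCast_atTop : Tendsto (fun p : ℕ => Real.log p) atTop atTop :=
  Real.tendsto_log_atTop.comp tendsto_natCast_atTop_atTop

lemma eventually_div_le {c : ℕ → ℝ} {k : ℕ} (hk : c =O[atTop] fun p : ℕ => Real.log p ^ k)
    {η : ℝ} (hη : 0 < η) : ∀ᶠ p : ℕ in atTop, c p / p ≤ η := by
  have h1 : (fun x : ℝ => Real.log x ^ k) =o[atTop] (id : ℝ → ℝ) :=
    Real.isLittleO_pow_log_id_atTop
  have h2 := (hk.trans_isLittleO (h1.comp_tendsto tendsto_natCast_atTop_atTop)).bound hη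
  filter_upwards [h2, eventually_gt_atTop 0] with p hp hp0
  have hp0' : (0 : ℝ) < p := by exact_mod_cast hp0
  rw [div_le_iff₀ hp0']
  have h3 : |c p| ≤ η * p := by simpa using hp
  exact (le_abs_self _).trans h3

/-- For sparse graphs with polylogarithmic average degree `c`, the entropy of the neighbourhood of
a node is at least `(1 - o(1)) c log p` nats. -/
lemma eventually_mul_log_le_binEntropy {c : ℕ → ℝ} {c₀ : ℝ} (hc₀ : 0 < c₀)
    (hc : ∀ᶠ p in atTop, c₀ ≤ c p) {k : ℕ} (hk : c =O[atTop] fun p : ℕ => Real.log p ^ k)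
    {κ : ℝ} (hκ0 : 0 ≤ κ) (hκ : κ < 1) :
    ∀ᶠ p : ℕ in atTop, κ * (c p * Real.log p) ≤ (p - 1) * Real.binEntropy (c p / p) := by
  -- One factor `1 - η` covers `1 - 1/p`, another covers `log p - log c`; then `(1 - η)² ≥ 1 - 2η =
  -- κ`.
  set η := (1 - κ) / 2 with hη
  have hη0 : 0 < η := by rw [hη]; linarith
  have hinv : ∀ᶠ p : ℕ in atTop, (p : ℝ)⁻¹ ≤ η :=
    (tendsto_inv_atTop_zero.comp tendsto_natCast_atTop_atTop).eventually_le_const hη0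
  filter_upwards [hc, eventually_log_le_mul_log hc₀ hc hk hη0, eventually_div_le hk one_half_pos,
    hinv, eventually_gt_atTop 0] with p hcp hlog hq hinv hp0
  have hp0' : (0 : ℝ) < p := by exact_mod_cast hp0
  have hp1 : (1 : ℝ) ≤ p := by exact_mod_cast hp0
  have hcp0 : 0 < c p := hc₀.trans_le hcp
  have hq0 : 0 < c p / p := by positivity
  have hlp : 0 ≤ Real.log p := Real.log_nonneg hp1
  have hH : c p / p * (Real.log p - Real.log (c p)) ≤ Real.binEntropy (c p / p) := by
    rw [Real.binEntropy_eq_negMulLog_add_negMulLog_one_sub]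
    have h1 := Real.negMulLog_nonneg (x := 1 - c p / p) (by linarith) (by linarith)
    rw [Real.negMulLog, Real.log_div hcp0.ne' hp0'.ne']
    linarith
  refine le_trans ?_ (mul_le_mul_of_nonneg_left hH (by linarith))
  have hfac : (p - 1) * (c p / p * (Real.log p - Real.log (c p))) =
      c p * ((1 - (p : ℝ)⁻¹) * (Real.log p - Real.log (c p))) := by field_simp
  have h2 : (1 - η) * ((1 - η) * Real.log p) ≤
      (1 - (p : ℝ)⁻¹) * (Real.log p - Real.log (c p)) := by
    refine mul_le_mul (by linarith) (by linarith) (mul_nonneg (by linarith) hlp) ?_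
    have : (p : ℝ)⁻¹ ≤ 1 := inv_le_one_of_one_le₀ hp1
    linarith
  rw [hfac, mul_left_comm]
  refine mul_le_mul_of_nonneg_left (le_trans ?_ h2) hcp0.le
  have h3 : κ = 1 - 2 * η := by rw [hη]; ring
  rw [h3]
  nlinarith [mul_nonneg (sq_nonneg η) hlp]

lemma binEntropyBits_eq (q : ℝ) : binEntropyBits q = Real.binEntropy q / Real.log 2 := by
  rw [Real.binEntropy_eq_negMulLog_add_negMulLog_one_sub, binEntropyBits, Real.logb, Real.logb,
    Real.negMulLog, Real.negMulLog]
  ring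

lemma log_inv_lt_log_two_pi_exp {α : ℝ} (hα : α < 1) :
    Real.log (1 - α)⁻¹ < Real.log (2 * Real.pi * Real.exp 1 * (1 / (1 - α) + 1)) := by
  have hs : 0 < (1 - α)⁻¹ := inv_pos.mpr (by linarith)
  refine Real.log_lt_log hs ?_
  rw [one_div]
  have h1 : 1 ≤ 2 * Real.pi * Real.exp 1 := by
    have := Real.pi_gt_three
    have := Real.one_le_exp zero_le_one
    nlinarith
  nlinarith

lemma sqrt_pow_pow_eq_exp {s : ℝ} (hs : 0 < s) (p n : ℕ) :
    Real.sqrt (s ^ p) ^ n = Real.exp (n * (p * Real.log s / 2)) := by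
  have h : Real.sqrt (s ^ p) = Real.exp (p * Real.log s / 2) := by
    rw [Real.exp_half, Real.exp_nat_mul, Real.exp_log hs]
  rw [h, Real.exp_nat_mul]

/-- With too few samples, the likelihood-ratio exponent cannot offset the prior exponent `(1 - ε) N
H`: the sum stays below `-ε N H`. -/
lemma mul_half_le_of_lt {N H S r l L δ ε : ℝ} {n : ℕ} (hl : l = r * L) (hr : 0 ≤ r)
    (hNH : 0 ≤ N * H) (hδ : δ * r ≤ 1 - 2 * ε) (hlt : n * (S * L / 2) < δ * (N * H)) :
    -((1 - ε) * (N * H)) + n * (S * l / 2) ≤ -(ε * (N * H)) := by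
  have h1 : n * (S * l / 2) = r * (n * (S * L / 2)) := by rw [hl]; ring
  have h2 := mul_le_mul_of_nonneg_left hlt.le hr
  have h3 := mul_le_mul_of_nonneg_right hδ hNH
  rw [h1]
  linarith

/-! ### The sample lower bound -/

/-- If the error probability vanishes, the number of samples exceeds, by a fixed factor larger than
one, the ratio of the graph entropy to the information bound per sample. -/
lemma exists_one_lt_eventually_le_samples
    {α : ℝ} (hα : α < 1) {c : ℕ → ℝ} {c₀ : ℝ} (hc₀ : 0 < c₀) (hc : ∀ᶠ p in atTop, c₀ ≤ c p)
    {k : ℕ} (hk : c =O[atTop] fun p : ℕ => Real.log p ^ k)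
    {J : ∀ p : ℕ, SimpleGraph (Fin p) → Matrix (Fin p) (Fin p) ℝ}
    (hJ : ∀ p G, (J p G).PosDef) (hdiag : ∀ p G i, J p G i i = 1)
    (hws : Tendsto (fun p : ℕ => erdosRenyi p (c p) {G | WalkSummable α (J p G)}) atTop (𝓝 1))
    {n : ℕ → ℕ} {est : ∀ p : ℕ, (Fin (n p) → Fin p → ℝ) → SimpleGraph (Fin p)}
    (hest : ∀ p, Measurable (est p))
    (herr : Tendsto (fun p : ℕ => errorProb (erdosRenyi p (c p)) (J p) (n p) (est p))
      atTop (𝓝 0)) :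
    ∃ δ : ℝ, 1 < δ ∧ ∀ᶠ p : ℕ in atTop,
      δ * (p.choose 2 * Real.binEntropy (c p / p)) ≤
        n p * (p * Real.log (2 * Real.pi * Real.exp 1 * (1 / (1 - α) + 1)) / 2) := by
  have hprob : ∀ p, IsProbabilityMeasure (erdosRenyi p (c p)) := fun p => by
    unfold erdosRenyi; infer_instance
  -- A single walk-summable graph suffices; this makes `l`, hence `r`, nonnegative.
  have hα0 : 0 ≤ α := by
    obtain ⟨p, hp⟩ := (hws.eventually_const_lt (u := 0) one_pos).exists
    obtain ⟨G, hG⟩ := nonempty_of_measure_ne_zero hp.ne'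
    exact hG.nonneg
  have hs : 0 < (1 - α)⁻¹ := inv_pos.mpr (by linarith)
  set l := Real.log (1 - α)⁻¹ with hl
  set L := Real.log (2 * Real.pi * Real.exp 1 * (1 / (1 - α) + 1)) with hL
  have hl0 : 0 ≤ l := Real.log_nonneg ((one_le_inv₀ (by linarith)).mpr (by linarith))
  have hlL : l < L := log_inv_lt_log_two_pi_exp hα
  have hL0 : 0 < L := hl0.trans_lt hlL
  set r := l / L with hr
  have hr0 : 0 ≤ r := div_nonneg hl0 hL0.le
  have hr1 : r < 1 := (div_lt_one hL0).mpr hlL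
  have hlr : l = r * L := by rw [hr]; field_simp
  set ε := (1 - r) / 4 with hε
  have hε0 : 0 < ε := by rw [hε]; linarith
  refine ⟨1 + (1 - r) / 2, by linarith, ?_⟩
  -- The difference of the two sides is `(1 - r)² / 2`.
  have hδr : (1 + (1 - r) / 2) * r ≤ 1 - 2 * ε := by rw [hε]; nlinarith
  -- Each of the four terms in `one_le_errorProb_add` will be below `1/4`, a contradiction.
  have hquarter : (0 : ENNReal) < 1 / 4 := by simp
  have hcompl : Tendsto
      (fun p : ℕ => erdosRenyi p (c p) {G | WalkSummable α (J p G)}ᶜ) atTop (𝓝 0) := by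
    have h := ENNReal.Tendsto.sub (tendsto_const_nhds (x := (1 : ENNReal))) hws
      (Or.inl ENNReal.one_ne_top)
    rw [tsub_self] at h
    refine h.congr fun p => ?_
    rw [prob_compl_eq_one_sub (Set.toFinite _).measurableSet]
  have hmean : Tendsto (fun p : ℕ => ((p : ℝ) - 1) * c₀ / 2) atTop atTop := by
    refine Tendsto.atTop_div_const two_pos (Tendsto.atTop_mul_const hc₀ ?_)
    exact tendsto_atTop_add_const_right _ (-1) tendsto_natCast_atTop_atTop
  have hexp : ∀ K : ℝ, 0 < K →
      ∀ᶠ p : ℕ in atTop, Real.exp (-(K * (((p : ℝ) - 1) * c₀ / 2))) < 1 / 4 := fun K hK =>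
    (Real.tendsto_exp_neg_atTop_nhds_zero.comp
      (hmean.const_mul_atTop hK)).eventually_lt_const (by norm_num)
  filter_upwards [hc, herr.eventually_lt_const hquarter, hcompl.eventually_lt_const hquarter,
    hexp (ε ^ 2 / 2) (by positivity), hexp (ε / 2) (by positivity),
    eventually_mul_log_le_binEntropy hc₀ hc hk (κ := 1 / 2) (by norm_num) (by norm_num),
    eventually_div_le hk one_half_pos, eventually_gt_atTop 1,
    tendsto_log_natCast_atTop.eventually_ge_atTop 1]
    with p hcp h1 h2 h3 h4 hH hq hp1 hlogp
  have hp1' : (1 : ℝ) < p := by exact_mod_cast hp1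
  have hcp0 : 0 < c p := hc₀.trans_le hcp
  have hq0 : 0 < c p / p := by positivity
  set q : unitInterval := Set.projIcc (0 : ℝ) 1 zero_le_one (c p / p) with hqdef
  have hqc : (q : ℝ) = c p / p := by
    rw [hqdef, Set.projIcc_of_mem _ ⟨hq0.le, by linarith⟩]
  have hER : erdosRenyi p (c p) = SimpleGraph.binomialRandom (Fin p) q := rfl
  have hN : (p.choose 2 : ℝ) = p * (p - 1) / 2 := Nat.cast_choose_two ℝ p
  have hNq : ((p : ℝ) - 1) * c₀ / 2 ≤ p.choose 2 * (c p / p) := by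
    have : (p.choose 2 : ℝ) * (c p / p) = (p - 1) * c p / 2 := by rw [hN]; field_simp
    rw [this]
    have : 0 ≤ (p : ℝ) - 1 := by linarith
    gcongr
  have hNH : ((p : ℝ) - 1) * c₀ / 2 ≤ 2 * (p.choose 2 * Real.binEntropy (c p / p)) := by
    have e : 2 * ((p.choose 2 : ℝ) * Real.binEntropy (c p / p)) =
      p * ((p - 1) * Real.binEntropy (c p / p)) := by rw [hN]; ring
    rw [e]
    have h5 : c₀ * 1 ≤ c p * Real.log p := mul_le_mul hcp hlogp zero_le_one hcp0.le
    have h6 := mul_le_mul_of_nonneg_left (hH.trans' (mul_le_mul_of_nonneg_left h5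
      (by norm_num : (0 : ℝ) ≤ 1 / 2))) (by linarith : (0 : ℝ) ≤ p)
    linarith
  have hNH0 : 0 ≤ (p.choose 2 : ℝ) * Real.binEntropy (c p / p) := by
    have : 0 ≤ ((p : ℝ) - 1) * c₀ / 2 :=
      div_nonneg (mul_nonneg (by linarith) hc₀.le) two_pos.le
    linarith
  by_contra hcon
  rw [not_le] at hcon
  set B : Set (SimpleGraph (Fin p)) :=
    {G | (G.edgeSet.ncard : ℝ) ≤ (1 - ε) * (p.choose 2 * q)} with hB
  have hBbound : erdosRenyi p (c p) B < 1 / 4 := by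
    have h5 : (erdosRenyi p (c p)).real B < 1 / 4 := by
      refine lt_of_le_of_lt (binomialRandom_edges_lower_tail q (by rw [hqc]; exact hq0)
        (by rw [hqc]; linarith) hε0.le) (lt_of_le_of_lt (Real.exp_le_exp.mpr ?_) h3)
      rw [hqc]
      have := mul_le_mul_of_nonneg_left hNq (by positivity : 0 ≤ ε ^ 2 / 2)
      linarith
    rw [← ofReal_measureReal]
    refine (ENNReal.ofReal_lt_ofReal_iff (by norm_num)).mpr h5 |>.trans_eq ?_
    rw [ENNReal.ofReal_div_of_pos (by norm_num)]; simp
  have hmass : ∀ G ∉ B, erdosRenyi p (c p) {G} ≤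
      ENNReal.ofReal (Real.exp (-((1 - ε) * (p.choose 2 * Real.binEntropy (c p / p))))) := by
    intro G hG
    rw [← ofReal_measureReal]
    refine ENNReal.ofReal_le_ofReal ?_
    have := binomialRandom_real_singleton_le q (by rw [hqc]; exact hq0) (by rw [hqc]; exact hq)
      hε0.le (G := G) (not_le.mp hG).le
    rwa [hqc] at this
  have hratio : ENNReal.ofReal
      (Real.exp (-((1 - ε) * (p.choose 2 * Real.binEntropy (c p / p))))) *
      ENNReal.ofReal (Real.sqrt ((1 - α)⁻¹ ^ p)) ^ n p < 1 / 4 := by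
    rw [← ENNReal.ofReal_pow (Real.sqrt_nonneg _), ← ENNReal.ofReal_mul (Real.exp_pos _).le,
      sqrt_pow_pow_eq_exp hs, ← Real.exp_add]
    have h6 := mul_half_le_of_lt hlr hr0 hNH0 hδr hcon
    have h7 : Real.exp (-((1 - ε) * (p.choose 2 * Real.binEntropy (c p / p))) +
        n p * (p * l / 2)) < 1 / 4 := by
      refine lt_of_le_of_lt (Real.exp_le_exp.mpr (h6.trans ?_)) h4
      have := mul_le_mul_of_nonneg_left hNH (by positivity : 0 ≤ ε / 2)
      linarith
    refine (ENNReal.ofReal_lt_ofReal_iff (by norm_num)).mpr h7 |>.trans_eq ?_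
    rw [ENNReal.ofReal_div_of_pos (by norm_num)]; simp
  have hone := one_le_errorProb_add (erdosRenyi p (c p)) (hJ p) (hdiag p) hα (hest p) hmass
  refine hone.not_gt ?_
  calc _ < (1 / 4 + 1 / 4 + 1 / 4 + 1 / 4 : ENNReal) :=
        ENNReal.add_lt_add (ENNReal.add_lt_add (ENNReal.add_lt_add h1 h2) hBbound) hratio
    _ = 1 := by
        have e : (1 / 4 : ENNReal) = ENNReal.ofReal (1 / 4) := by
          rw [ENNReal.ofReal_div_of_pos (by norm_num)]; simp
        rw [e, ← ENNReal.ofReal_add (by norm_num) (by norm_num),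
          ← ENNReal.ofReal_add (by norm_num) (by norm_num),
          ← ENNReal.ofReal_add (by norm_num) (by norm_num), ← ENNReal.ofReal_one]
        norm_num

end GaussianGraphical

end

theorem theorem3
    (α : ℝ) (hα : α < 1)
    -- the (possibly varying) average degree: bounded below and polylogarithmic; e.g. a constant
    (c : ℕ → ℝ) (hc_pos : ∃ c₀ : ℝ, 0 < c₀ ∧ ∀ᶠ p in atTop, c₀ ≤ c p)
    (hc_growth : ∃ k : ℕ, c =O[atTop] fun p : ℕ => Real.log p ^ k)
    -- a precision matrix with unit diagonal for every graph
    (J : ∀ p : ℕ, SimpleGraph (Fin p) → Matrix (Fin p) (Fin p) ℝ)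
    (hJ : ∀ (p : ℕ) (G : SimpleGraph (Fin p)), GaussianGraphical.IsPrecisionOn G (J p G))
    (hdiag : ∀ (p : ℕ) (G : SimpleGraph (Fin p)) (i : Fin p), J p G i i = 1)
    -- walk-summability for almost every graph
    (hws : Tendsto
      (fun p : ℕ => GaussianGraphical.erdosRenyi p (c p)
        {G | GaussianGraphical.WalkSummable α (J p G)}) atTop (𝓝 1))
    -- sample sizes and estimators
    (n : ℕ → ℕ)
    (est : ∀ p : ℕ, (Fin (n p) → Fin p → ℝ) → SimpleGraph (Fin p))
    (hest : ∀ p : ℕ, Measurable (est p))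
    (herr : Tendsto
      (fun p : ℕ => GaussianGraphical.errorProb
        (GaussianGraphical.erdosRenyi p (c p)) (J p) (n p) (est p)) atTop (𝓝 0)) :
    (∀ᶠ p : ℕ in atTop,
      2 / (p * Real.logb 2 (2 * Real.pi * Real.exp 1 * (1 / (1 - α) + 1))) * (p.choose 2 : ℝ)
        * GaussianGraphical.binEntropyBits (c p / p) ≤ (n p : ℝ)) ∧
    (∀ᶠ p : ℕ in atTop,
      c p * Real.logb 2 p / Real.logb 2 (2 * Real.pi * Real.exp 1 * (1 / (1 - α) + 1))
        ≤ (n p : ℝ)) := by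
  obtain ⟨c₀, hc₀, hc⟩ := hc_pos
  obtain ⟨k, hk⟩ := hc_growth
  obtain ⟨δ, hδ, hmain⟩ := GaussianGraphical.exists_one_lt_eventually_le_samples hα hc₀ hc hk
    (fun p G => (hJ p G).posDef) hdiag hws hest herr
  have hlog2 : 0 < Real.log 2 := Real.log_pos one_lt_two
  have hL0 : 0 < Real.log (2 * Real.pi * Real.exp 1 * (1 / (1 - α) + 1)) := by
    refine Real.log_pos ?_
    have h1 : 0 < 1 / (1 - α) := one_div_pos.mpr (by linarith)
    have h2 : 1 < 2 * Real.pi * Real.exp 1 := by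
      have := Real.pi_gt_three
      have := Real.one_le_exp zero_le_one
      nlinarith
    nlinarith
  set L := Real.log (2 * Real.pi * Real.exp 1 * (1 / (1 - α) + 1)) with hL
  -- The spare factor `δ` exactly cancels the loss `κ = δ⁻¹` in the entropy estimate.
  have hent := GaussianGraphical.eventually_mul_log_le_binEntropy hc₀ hc hk (κ := δ⁻¹)
    (by positivity) (inv_lt_one_of_one_lt₀ hδ)
  have hbound : ∀ᶠ p : ℕ in atTop,
      δ * (((p : ℝ) - 1) * Real.binEntropy (c p / p)) ≤ n p * L ∧
      0 ≤ ((p : ℝ) - 1) * Real.binEntropy (c p / p) ∧ 0 < (p : ℝ) := by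
    filter_upwards [hmain, hent, hc, eventually_gt_atTop 0] with p hp he hcp hp0
    have hp0' : (0 : ℝ) < p := by exact_mod_cast hp0
    have hp1 : (1 : ℝ) ≤ p := by exact_mod_cast hp0
    refine ⟨?_, le_trans ?_ he, hp0'⟩
    · rw [Nat.cast_choose_two] at hp
      refine le_of_mul_le_mul_left ?_ (half_pos hp0')
      linarith
    · have := Real.log_nonneg hp1
      have : 0 < c p := hc₀.trans_le hcp
      positivity
  constructor
  · filter_upwards [hbound] with p ⟨hp, hH, hp0⟩
    have e : 2 / (p * Real.logb 2 (2 * Real.pi * Real.exp 1 * (1 / (1 - α) + 1))) *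
        (p.choose 2 : ℝ) * GaussianGraphical.binEntropyBits (c p / p) =
        ((p : ℝ) - 1) * Real.binEntropy (c p / p) / L := by
      rw [GaussianGraphical.binEntropyBits_eq, Real.logb, ← hL, Nat.cast_choose_two]
      field_simp
    rw [e, div_le_iff₀ hL0]
    nlinarith
  · filter_upwards [hbound, hent] with p ⟨hp, hH, hp0⟩ he
    have e : c p * Real.logb 2 p /
        Real.logb 2 (2 * Real.pi * Real.exp 1 * (1 / (1 - α) + 1)) = c p * Real.log p / L := by
      rw [Real.logb, Real.logb, ← hL]
      field_simp
    rw [e, div_le_iff₀ hL0]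
    refine le_trans ?_ hp
    rwa [inv_mul_le_iff₀ (by linarith)] at he
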